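/- **Definitions.** A *position-faithful one-tape Turing machine* with finite input alphabet $\Sigma$ is a deterministic one-tape Turing machine (finitely many states and tape symbols) whose tape is infinite to the right only; the left-most cell holds a marker $\boxplus$ that occurs only there and cannot be modified, and the initial tape is $\boxplus x\boxdot^\infty$ with $x\in\Sigma^*$, $\boxdot$ the blank and the head on $\boxplus$. It computes $f:\Sigma^*\to\Sigma^*$ *in linear time* if there is a constant $c$ such that on each input $x\in\Sigma^*$ it reaches an accepting state and halts within $c(|x|+1)$ steps, with tape content starting with $\boxplus f(x)\boxdot$. Let $S$ be a finite subset of a group $G$. A bijection $\psi:L\to G$, where $L\subseteq\Sigma^*$ is a language over a finite alphabet, is a *Cayley position-faithful linear-time computable representation* of $G$ with respect to $S$ if for every $s\in S$ there is a function $f_s:\Sigma^*\to\Sigma^*$ computed in linear time by a position-faithful one-tape Turing machine such that $f_s(L)\subseteq L$ and $\psi(f_s(w))=\psi(w)s$ for all $w\in L$. A finitely generated group $G$ is *Cayley position-faithful linear-time computable* if it has such a representation with respect to every finite set $S$ of semigroup generators of $G$. The *convolution* of a finite family of words is the word of the maximal length whose $j$-th letter is the tuple of the $j$-th letters of the members,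 with a padding symbol for the members that are too short. A relation on words is *FA-recognizable* if the convolutions of its members form a regular language. For an integer $k>0$ let $\mathbb Z[1/k]=\{d/k^{\ell}: d,\ell\in\mathbb Z,\ \ell\ge 0\}$. An *FA-presentation* of $(\mathbb Z[1/k],+)$ is a bijection $\varphi:L_1\to\mathbb Z[1/k]$ from a regular language $L_1$ over a finite alphabet such that $\{(u,v,w)\in L_1^3:\varphi(u)+\varphi(v)=\varphi(w)\}$ is FA-recognizable. For such $\varphi$ and $n\ge 0$, let $L_n$ be the set of convolutions of families $(u_{ij})_{1\le i,j\le n}$ of words of $L_1$, and let $\varphi_n:L_n\to M_n(\mathbb Z[1/k])$ be the bijection taking the convolution of $(u_{ij})$ to the matrix $(\varphi(u_{ij}))$. **Theorem.** Let $G$ be a finitely generated subgroup of $\mathrm{GL}(n,\mathbb Q)$. Then $G$ is Cayley position-faithful linear-time computable. Moreover, there are an integer $k>0$ and an FA-presentation $\varphi:L_1\to\mathbb Z[1/k]$ of $(\mathbb Z[1/k],+)$ such that: 1. all entries of all matrices in $G$ lie in $\mathbb Z[1/k]$; 2. for every $g\in G$ (in particular for every generator) the relation $\{(u,v)\in L_n\times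 L_n:\varphi_n(u)\,g=\varphi_n(v)\}$ is FA-recognizable; 3. with the language of normal forms $L=\varphi_n^{-1}(G)$, the restriction $\psi=\varphi_n|_L:L\to G$ is a Cayley position-faithful linear-time computable representation of $G$ with respect to every finite $S\subseteq G$, in particular every finite set of semigroup generators. -/

import Mathlib

/-! ### Position-faithful one-tape Turing machines -/

/-- Contents of a tape cell to the right of the end marker, for a machine with input alphabet `A`
and additional work symbols `W`. -/
inductive PFCell (A W : Type) : Type where
  | blank : PFCell A W
  | letter (a : A) : PFCell A W
  | work (w : W) : PFCell A W

/-- Head movements. -/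
inductive PFMove : Type where
  | left : PFMove
  | stay : PFMove
  | right : PFMove

/-- A deterministic position-faithful one-tape Turing machine with input alphabet `A`. The tape is
infinite to the right only, and its left-most position holds an end marker, which occurs nowhere
else and cannot be modified: in the marked position the machine only changes its state and either
stays there (`false`) or moves right (`true`); in every other position it reads the cell, changes
its state, writes a symbol other than the end marker, and moves. -/
structure PFMachine (A : Type) where
  State : Type
  Work : Type
  finite_state : Finite State
  finite_work : Finite Work
  start : State
  accept : State → Bool
  atMarker : State → State × Bool
  atCell : State → PFCell A Work → State × PFCell A Work × PFMove

namespace PFMachine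

variable {A : Type}

/-- A configuration. Head position `0` is the end marker, and head position `p + 1` is the cell
whose content is `tape p`. -/
structure Config (M : PFMachine A) where
  state : M.State
  head : ℕ
  tape : ℕ → PFCell A M.Work

/-- The part of the tape right of the end marker when it holds the word `x` followed by blanks. -/
def tapeOf (M : PFMachine A) (x : List A) (i : ℕ) : PFCell A M.Work :=
  match x[i]? with
  | some a => PFCell.letter a
  | none => PFCell.blank

/-- The initial configuration on input `x`: the head is on the end marker. -/
def init (M : PFMachine A) (x : List A) : M.Config :=
  { state := M.start, head := 0, tape := M.tapeOf x }

/-- One computation step; the machine halts in its accepting states. -/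
def step (M : PFMachine A) (c : M.Config) : M.Config :=
  if M.accept c.state then c
  else
    match c.head with
    | 0 =>
      { state := (M.atMarker c.state).1
        head := if (M.atMarker c.state).2 then 1 else 0
        tape := c.tape }
    | p + 1 =>
      { state := (M.atCell c.state (c.tape p)).1
        head :=
          match (M.atCell c.state (c.tape p)).2.2 with
          | PFMove.left => p
          | PFMove.stay => p + 1
          | PFMove.right => p + 2
        tape := Function.update c.tape p (M.atCell c.state (c.tape p)).2.1 }

/-- The configuration after `t` steps on input `x`. -/
def run (M : PFMachine A) (x : List A) (t : ℕ) : M.Config := (M.step)^[t] (M.init x)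

/-- `M` computes `f` within time `T` (a function of the input length): on every input `x` it
reaches an accepting state after at most `T |x|` steps, and then the word `f x` followed by
a blank stands right of the end marker. Nothing is required of the cells beyond that blank. -/
def ComputesInTime (M : PFMachine A) (f : List A → List A) (T : ℕ → ℕ) : Prop :=
  ∀ x : List A, ∃ t ≤ T x.length, M.accept (M.run x t).state = true ∧
    ∀ i ≤ (f x).length, (M.run x t).tape i = M.tapeOf (f x) i

end PFMachine

/-- `f` is computed by a deterministic position-faithful one-tape Turing machine in linear time. -/
def IsPFLinearTimeComputable {A : Type} (f : List A → List A) : Prop :=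
  ∃ (M : PFMachine A) (c : ℕ), M.ComputesInTime f (fun m => c * (m + 1))

/-! ### Cayley position-faithful linear-time computable groups -/

/-- `ψ`, restricted to the language `L`, is a Cayley position-faithful linear-time computable
representation of `G` with respect to the set `S`. Only the values of `ψ` on `L` matter. -/
def IsCayleyPFLinearTimeRepresentation {G : Type*} [Group G] (S : Set G) {A : Type}
    (L : Set (List A)) (ψ : List A → G) : Prop :=
  Set.BijOn ψ L Set.univ ∧
    ∀ s ∈ S, ∃ f : List A → List A, IsPFLinearTimeComputable f ∧
      ∀ w ∈ L, f w ∈ L ∧ ψ (f w) = ψ w * s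

/-- `G` is finitely generated and, for every finite set `S` of semigroup generators, has a Cayley
position-faithful linear-time computable representation over a finite alphabet. -/
def IsCayleyPFLinearTimeComputable (G : Type*) [Group G] : Prop :=
  Group.FG G ∧ ∀ S : Set G, S.Finite → Submonoid.closure S = ⊤ →
    ∃ (A : Type) (_ : Finite A) (L : Set (List A)) (ψ : List A → G),
      IsCayleyPFLinearTimeRepresentation S L ψ

/-! ### Convolutions and relations recognized by finite automata -/

/-- The convolution of a finite family of words: the word, of the maximal length, whose `j`-th
letter is the tuple of the `j`-th letters, where `none` is the padding symbol. -/
def convolution {ι A : Type} [Fintype ι] (u : ι → List A) : List (ι → Option A) :=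
  (List.range (Finset.univ.sup fun i => (u i).length)).map fun j i => (u i)[j]?

/-- A relation on words is recognizable by a finite (synchronous multi-tape) automaton if the
convolutions of its members form a regular language. -/
def IsFARecognizable {ι A : Type} [Fintype ι] (R : Set (ι → List A)) : Prop :=
  Language.IsRegular (convolution '' R : Language (ι → Option A))

/-- The rational numbers `d / k ^ ℓ` with `d` an integer and `ℓ ≥ 0`. -/
def integersAdjoinInv (k : ℕ) : Set ℚ :=
  {x | ∃ (d : ℤ) (l : ℕ), x = (d : ℚ) / (k : ℚ) ^ l}

/-- `φ`, restricted to the language `L₁`, is an FA-presentation of the additive group `ℤ[1/k]`. -/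
def IsFAPresentation (k : ℕ) {A : Type} (L₁ : Set (List A)) (φ : List A → ℚ) : Prop :=
  Language.IsRegular (L₁ : Language A) ∧ Set.BijOn φ L₁ (integersAdjoinInv k) ∧
    IsFARecognizable {u : Fin 3 → List A | (∀ i, u i ∈ L₁) ∧ φ (u 0) + φ (u 1) = φ (u 2)}

/-- The word `w` is the convolution of the `φ`-representatives in `L₁` of the entries of `C`. -/
def EncodesMatrix {n : ℕ} {A : Type} (L₁ : Set (List A)) (φ : List A → ℚ)
    (w : List (Fin n × Fin n → Option A)) (C : Matrix (Fin n) (Fin n) ℚ) : Prop :=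
  ∃ u : Fin n × Fin n → List A, (∀ p, u p ∈ L₁) ∧ (∀ i j, φ (u (i, j)) = C i j) ∧
    w = convolution u

/-! Only finitely many denominators occur in the generators and their inverses, so all entries of
all elements of `G` lie in ℤ[1/k] for one k ≥ 3. A number in ℤ[1/k] is written with balanced digits
in base k, which need no sign. Its integral and fractional digits are placed on two tracks, both
read outward from the radix point, so that words are aligned at the point and padding only adds
zeros at the far ends. Forbidding trailing zeros makes this a bijection (`bijOn_wordValue`).

An integer linear condition on several such numbers says that a word of integer digits, obtained
letter by letter, has value zero. A finite automaton checks this (`isRegular_value_eq_zero`): the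
fractional part is bounded, so only finitely many integers have to be tried as its value, and on
each track the value still to be produced stays bounded. Addition is such a condition. So is `C * g
= D` for a fixed rational matrix `g`, entry by entry, once denominators are cleared
(`isFARecognizable_mul_matrix`).

A function with a recognizable graph is computed in linear time on one tape
(`exists_isPFLinearTimeComputable`). A pass to the right stores the sets of reachable automaton
states along the input, a tail of bounded length is appended, and a pass to the left follows an
accepting path backwards and writes the output. For right multiplication by an element of `G` the
graph is that of a function because each matrix has exactly one code word. -/

/-! ### Regular languages -/

/-- A family of languages that is closed under left quotients by letters, up to the empty language,
and indexed by a finite set, consists of regular languages. -/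
theorem Language.isRegular_of_family {α σ : Type*} (L : σ → Language α) {T : Set σ} (hT : T.Finite)
    (step : σ → α → σ) (hstep : ∀ s ∈ T, ∀ a w, a :: w ∈ L s ↔ w ∈ L (step s a))
    (hmem : ∀ s ∈ T, ∀ a, step s a ∈ T ∨ ∀ w, w ∉ L (step s a)) {s : σ} (hs : s ∈ T) :
    (L s).IsRegular := by
  refine .of_finite_range_leftQuotient (((hT.image L).insert (0 : Language α)).subset ?_)
  rintro _ ⟨w, rfl⟩
  induction w generalizing s with
  | nil => exact Or.inr ⟨s, hs, rfl⟩
  | cons a w ih =>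
    have hq : (L s).leftQuotient (a :: w) = (L (step s a)).leftQuotient w :=
      Set.ext fun z => hstep s hs a (w ++ z)
    rw [hq]
    rcases hmem s hs a with h | h
    · exact ih h
    · exact Or.inl (Set.ext fun z => ⟨fun hz => (h _ hz).elim, fun hz => hz.elim⟩)

theorem Language.IsRegular.congr {α : Type*} {L L' : Language α} (h : L.IsRegular)
    (e : ∀ w, w ∈ L' ↔ w ∈ L) : L'.IsRegular :=
  (Set.ext e : L' = L) ▸ h

theorem Language.IsRegular.biInter {α ι : Type*} {p : ι → List α → Prop} (s : Finset ι)
    (h : ∀ i ∈ s, Language.IsRegular ({w | p i w} : Language α)) :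
    Language.IsRegular ({w | ∀ i ∈ s, p i w} : Language α) := by
  classical
  induction s using Finset.induction_on with
  | empty =>
    refine Language.isRegular_of_family (σ := Unit) (T := Set.univ) (s := ())
      (fun _ => ({w | ∀ i ∈ (∅ : Finset ι), p i w} : Language α)) Set.finite_univ (fun s _ => s)
      ?_ ?_ trivial
    · intro s _ a w
      exact ⟨fun _ i hi => by simp at hi, fun _ i hi => by simp at hi⟩
    · exact fun _ _ _ => Or.inl trivial
  | insert i s _ ih =>
    refine ((h i (Finset.mem_insert_self i s)).inf
      (ih fun j hj => h j (Finset.mem_insert_of_mem hj))).congr fun w => ?_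
    exact Finset.forall_mem_insert ..

theorem Language.IsRegular.iInter {α ι : Type*} [Finite ι] {p : ι → List α → Prop}
    (h : ∀ i, Language.IsRegular ({w | p i w} : Language α)) :
    Language.IsRegular ({w | ∀ i, p i w} : Language α) := by
  have := Fintype.ofFinite ι
  simpa using Language.IsRegular.biInter Finset.univ fun i _ => h i

theorem Language.IsRegular.iUnion {α ι : Type*} [Finite ι] {p : ι → List α → Prop}
    (h : ∀ i, Language.IsRegular ({w | p i w} : Language α)) :
    Language.IsRegular ({w | ∃ i, p i w} : Language α) := by
  exact (Language.IsRegular.iInter fun i => (h i).compl).compl.congr fun w =>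
    not_forall_not.symm

/-- The automaton for `L` stands still on the letters that `f` erases. With `f` a coordinate of a
column, this imposes a regular condition on one component of a convolution. -/
theorem Language.IsRegular.preimage_filterMap {α β : Type*} (f : β → Option α) {L : Language α}
    (h : L.IsRegular) : Language.IsRegular ({w | w.filterMap f ∈ L} : Language β) := by
  obtain ⟨σ, _, M, rfl⟩ := h
  refine Language.isRegular_of_family (σ := σ) (T := Set.univ) (s := M.start)
    (fun s => ({w | M.evalFrom s (w.filterMap f) ∈ M.accept} : Language β)) Set.finite_univ
    (fun s b => (f b).elim s (M.step s)) ?_ (fun _ _ _ => Or.inl trivial) trivial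
  intro s _ b w
  change M.evalFrom s ((b :: w).filterMap f) ∈ M.accept ↔
    M.evalFrom ((f b).elim s (M.step s)) (w.filterMap f) ∈ M.accept
  cases hb : f b <;> simp [hb]

/-! ### Convolutions -/

section Convolution

variable {ι A : Type} [Fintype ι]

theorem getElem?_convolution (u : ι → List A) (c : ι) (j : ℕ) :
    (convolution u)[j]?.bind (· c) = (u c)[j]? := by
  simp only [convolution, List.getElem?_map]
  by_cases hj : j < Finset.univ.sup fun i => (u i).length
  · simp [List.getElem?_range hj]
  · have hc : (u c).length ≤ j :=
      (Finset.le_sup (f := fun i => (u i).length) (Finset.mem_univ c)).trans (not_lt.1 hj)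
    rw [List.getElem?_eq_none (by simpa using hj), List.getElem?_eq_none hc]
    rfl

theorem length_convolution (u : ι → List A) :
    (convolution u).length = Finset.univ.sup fun i => (u i).length := by
  simp [convolution]

theorem convolution_injective : Function.Injective (convolution : (ι → List A) → _) := by
  intro u v h
  funext c
  refine List.ext_getElem? fun j => ?_
  rw [← getElem?_convolution u, h, getElem?_convolution]

theorem map_convolution (u : ι → List A) (c : ι) :
    (convolution u).map (· c) =
      (u c).map some ++ List.replicate ((convolution u).length - (u c).length) none := by
  have hc : (u c).length ≤ (convolution u).length :=
    (Finset.le_sup (f := fun i => (u i).length) (Finset.mem_univ c)).trans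
      (length_convolution u).ge
  refine List.ext_getElem (by simp [hc]) fun j hj _ => ?_
  have h := getElem?_convolution u c j
  rw [List.length_map] at hj
  rw [List.getElem?_eq_getElem hj, Option.bind_some] at h
  rw [List.getElem_map, h, List.getElem_append]
  split
  · rename_i h'
    rw [List.length_map] at h'
    simp [h']
  · rename_i h'
    rw [List.length_map] at h'
    simpa using h'

theorem filterMap_convolution (u : ι → List A) (c : ι) :
    (convolution u).filterMap (· c) = u c := by
  have : (convolution u).filterMap (· c) = ((convolution u).map (· c)).filterMap id := by
    rw [List.filterMap_map]; rfl
  rw [this, map_convolution]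
  simp [List.filterMap_append, List.filterMap_map]

theorem convolution_eq_nil {u : ι → List A} : convolution u = [] ↔ ∀ c, u c = [] := by
  rw [← List.length_eq_zero_iff, length_convolution]
  rw [← Nat.bot_eq_zero, Finset.sup_eq_bot_iff]
  simp

theorem convolution_cons (u : ι → List A) (h : ∃ c, u c ≠ []) :
    convolution u = (fun c => (u c).head?) :: convolution fun c => (u c).tail := by
  refine List.ext_getElem ?_ fun j hj hj' => funext fun c => ?_
  · rw [List.length_cons, length_convolution, length_convolution]
    obtain ⟨c, hc⟩ := h
    have hpos : 1 ≤ Finset.univ.sup fun i => (u i).length :=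
      (List.length_pos_iff.2 hc).trans_le
        (Finset.le_sup (f := fun i => (u i).length) (Finset.mem_univ c))
    refine le_antisymm (Finset.sup_le fun i _ => ?_) ?_
    · have := Finset.le_sup (f := fun i => (u i).tail.length) (Finset.mem_univ i)
      simp only [List.length_tail] at this ⊢
      omega
    · refine Nat.add_le_of_le_sub hpos (Finset.sup_le fun i _ => ?_)
      have := Finset.le_sup (f := fun i => (u i).length) (Finset.mem_univ i)
      simp only [List.length_tail]
      omega
  · have h₁ := getElem?_convolution u c j
    rw [List.getElem?_eq_getElem hj, Option.bind_some] at h₁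
    rw [h₁]
    cases j with
    | zero => simp [List.head?_eq_getElem?]
    | succ j =>
      have h₂ := getElem?_convolution (fun c => (u c).tail) c j
      rw [List.getElem?_eq_getElem (by simpa using hj'), Option.bind_some] at h₂
      rw [List.getElem_cons_succ, h₂, List.getElem?_tail]

/-- The convolutions of families with empty members in the positions of `E`, for `s = some E`. -/
def convolutionsWithEmpty (s : Option (Set ι)) : Language (ι → Option A) :=
  {w | ∃ E, s = some E ∧ ∃ u, (∀ c ∈ E, u c = []) ∧ convolution u = w}

-- A word is a convolution exactly if every column has a nonpadding entry and a component, once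
-- padded, stays padded. The state is the set of components already exhausted; `none` is the dead
-- state.
open Classical in
theorem isRegular_range_convolution :
    Language.IsRegular (Set.range (convolution : (ι → List A) → _) : Language (ι → Option A)) := by
  have hr : (Set.range (convolution : (ι → List A) → _) : Language (ι → Option A)) =
      convolutionsWithEmpty (some ∅) :=
    Set.ext fun w => by simp [convolutionsWithEmpty]
  rw [hr]
  refine Language.isRegular_of_family (T := Set.univ) convolutionsWithEmpty Set.finite_univ
    (fun s x => s.bind fun E => if (∃ c, x c ≠ none) ∧ ∀ c ∈ E, x c = none then
      some {c | x c = none} else none) ?_ (fun _ _ _ => Or.inl trivial) trivial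
  intro s _ x w
  constructor
  · rintro ⟨E, rfl, u, hE, hu⟩
    have hne : ∃ c, u c ≠ [] := by
      by_contra! h
      rw [convolution_eq_nil.2 h] at hu
      cases hu
    rw [convolution_cons u hne] at hu
    obtain ⟨rfl, hw⟩ := List.cons.inj hu
    have hcond : (∃ c, (u c).head? ≠ none) ∧ ∀ c ∈ E, (u c).head? = none := by
      simpa using ⟨hne, hE⟩
    refine ⟨{c | (u c).head? = none}, by rw [Option.bind_some, if_pos hcond], _, ?_, hw⟩
    intro c hc
    rw [List.head?_eq_none_iff.1 hc, List.tail_nil]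
  · rintro ⟨E', hE', u, hu, rfl⟩
    cases s with
    | none => cases hE'
    | some E =>
      rw [Option.bind_some] at hE'
      split_ifs at hE' with hcond
      obtain rfl := Option.some.inj hE'
      refine ⟨E, rfl, fun c => (x c).toList ++ u c, fun c hc => ?_, ?_⟩
      · simp [hcond.2 c hc, hu c (hcond.2 c hc)]
      · obtain ⟨c₀, hc₀⟩ := hcond.1
        rw [convolution_cons _ ⟨c₀, by
          obtain ⟨a, ha⟩ := Option.ne_none_iff_exists'.1 hc₀
          simp [ha]⟩]
        congr 2
        · funext c
          cases hx : x c with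
          | none => simp [hu c hx]
          | some a => simp
        · funext c
          cases hx : x c with
          | none => simp [hu c hx]
          | some a => simp

/-- A relation cut out by a regular condition on each component and one on the convolution is
recognizable. -/
theorem isFARecognizable_of_isRegular {L : ι → Language A} (hL : ∀ c, (L c).IsRegular)
    {K : Language (ι → Option A)} (hK : K.IsRegular) :
    IsFARecognizable {u : ι → List A | (∀ c, u c ∈ L c) ∧ convolution u ∈ K} := by
  have h := (isRegular_range_convolution (ι := ι) (A := A)).inf
    ((Language.IsRegular.iInter fun c => (hL c).preimage_filterMap
      (fun x : ι → Option A => x c)).inf hK)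
  refine h.congr fun w => ?_
  constructor
  · rintro ⟨u, ⟨hu, huK⟩, rfl⟩
    refine ⟨⟨u, rfl⟩, fun c => ?_, huK⟩
    change (convolution u).filterMap (· c) ∈ L c
    rw [filterMap_convolution]
    exact hu c
  · rintro ⟨⟨u, rfl⟩, hu, huK⟩
    refine ⟨u, ⟨fun c => ?_, huK⟩, rfl⟩
    have : (convolution u).filterMap (· c) ∈ L c := hu c
    rwa [filterMap_convolution] at this

end Convolution

/-! ### Values of words in base `k` -/

section Values

variable {B C : Type}

/-- The value `∑ a (w j) k ^ j` of a word with the least significant digit first. -/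
def intValue (k : ℕ) (a : B → ℤ) : List B → ℤ
  | [] => 0
  | x :: w => a x + k * intValue k a w

/-- The value `∑ b (w j) / k ^ (j + 1)` of a word with the most significant digit first. -/
def fracValue (k : ℕ) (b : B → ℤ) : List B → ℚ
  | [] => 0
  | x :: w => (b x + fracValue k b w) / k

theorem intValue_map (k : ℕ) (f : C → B) (a : B → ℤ) (w : List C) :
    intValue k a (w.map f) = intValue k (fun x => a (f x)) w := by
  induction w with
  | nil => rfl
  | cons x w ih => simp [intValue, ih]

theorem fracValue_map (k : ℕ) (f : C → B) (a : B → ℤ) (w : List C) :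
    fracValue k a (w.map f) = fracValue k (fun x => a (f x)) w := by
  induction w with
  | nil => rfl
  | cons x w ih => simp [fracValue, ih]

theorem intValue_append (k : ℕ) (a : B → ℤ) (v w : List B) :
    intValue k a (v ++ w) = intValue k a v + k ^ v.length * intValue k a w := by
  induction v with
  | nil => simp [intValue]
  | cons x v ih => simp only [List.cons_append, intValue, ih, List.length_cons]; ring

theorem intValue_replicate (k : ℕ) {a : B → ℤ} {x : B} (hx : a x = 0) (m : ℕ) :
    intValue k a (List.replicate m x) = 0 := by
  induction m with
  | zero => rfl
  | succ m ih => simp [List.replicate_succ, intValue, ih, hx]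

theorem fracValue_append_replicate (k : ℕ) {b : B → ℤ} {x : B} (hx : b x = 0) (w : List B)
    (m : ℕ) : fracValue k b (w ++ List.replicate m x) = fracValue k b w := by
  induction w with
  | nil =>
    induction m with
    | zero => rfl
    | succ m ih => simp_all [List.replicate_succ, fracValue]
  | cons y w ih => simp [fracValue, ih]

theorem intValue_append_replicate (k : ℕ) {a : B → ℤ} {x : B} (hx : a x = 0) (w : List B)
    (m : ℕ) : intValue k a (w ++ List.replicate m x) = intValue k a w := by
  rw [intValue_append, intValue_replicate k hx, mul_zero, add_zero]

theorem intValue_reverse {k : ℕ} (hk : k ≠ 0) (b : B → ℤ) (w : List B) :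
    (intValue k b w.reverse : ℚ) = k ^ w.length * fracValue k b w := by
  induction w with
  | nil => simp [intValue, fracValue]
  | cons x w ih =>
    have hk' : (k : ℚ) ≠ 0 := by exact_mod_cast hk
    rw [List.reverse_cons, intValue_append]
    push_cast
    rw [ih]
    simp only [intValue, fracValue, List.length_reverse, List.length_cons, mul_zero, add_zero]
    field_simp
    ring

/-- Values are linear in the digits, so linear combinations of components can be formed column by
column, without carries, at the price of larger digits. -/
theorem intValue_sum {κ : Type*} (s : Finset κ) (k : ℕ) (c : κ → ℤ) (a : κ → B → ℤ) (w : List B) :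
    intValue k (fun x => ∑ i ∈ s, c i * a i x) w = ∑ i ∈ s, c i * intValue k (a i) w := by
  induction w with
  | nil => simp [intValue]
  | cons x w ih =>
    simp only [intValue, ih, Finset.mul_sum, mul_add, Finset.sum_add_distrib]
    congr 1
    exact Finset.sum_congr rfl fun i _ => by ring

theorem fracValue_sum {κ : Type*} (s : Finset κ) (k : ℕ) (c : κ → ℤ) (a : κ → B → ℤ) (w : List B) :
    fracValue k (fun x => ∑ i ∈ s, c i * a i x) w = ∑ i ∈ s, c i * fracValue k (a i) w := by
  induction w with
  | nil => simp [fracValue]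
  | cons x w ih =>
    simp only [fracValue, ih, Int.cast_sum, Int.cast_mul, ← Finset.sum_add_distrib,
      Finset.sum_div]
    exact Finset.sum_congr rfl fun i _ => by ring

/-- The geometric series with ratio 1/k sums to at most 1 when k ≥ 2. -/
theorem abs_fracValue_le {k : ℕ} (hk : 2 ≤ k) {b : B → ℤ} {m : ℕ} (hb : ∀ x, |b x| ≤ m)
    (w : List B) : |fracValue k b w| ≤ m := by
  have hk' : (2 : ℚ) ≤ k := by exact_mod_cast hk
  induction w with
  | nil => simp [fracValue]
  | cons x w ih =>
    have hbx : |(b x : ℚ)| ≤ m := by exact_mod_cast hb x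
    rw [fracValue, abs_div, abs_of_pos (by linarith : (0 : ℚ) < k), div_le_iff₀ (by linarith)]
    have hm : (0 : ℚ) ≤ m := Nat.cast_nonneg m
    calc |(b x : ℚ) + fracValue k b w| ≤ |(b x : ℚ)| + |fracValue k b w| := abs_add_le _ _
      _ ≤ m * 2 := by linarith
      _ ≤ m * k := by gcongr

theorem exists_abs_le_natCast [Finite B] (a : B → ℤ) : ∃ m : ℕ, ∀ x, |a x| ≤ m := by
  have := Fintype.ofFinite B
  refine ⟨Finset.univ.sup fun x => (a x).natAbs, fun x => ?_⟩
  rw [Int.abs_eq_natAbs]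
  exact_mod_cast Finset.le_sup (f := fun x => (a x).natAbs) (Finset.mem_univ x)

/-- The state is the value that the remaining digits must have. Reading a digit divides by k, so an
interval containing all digits and `e` is never left. States are rational to make the division
total; a nonintegral state accepts nothing. -/
theorem isRegular_intValue_eq [Finite B] {k : ℕ} (hk : 2 ≤ k) (a : B → ℤ) (e : ℤ) :
    Language.IsRegular ({w | (intValue k a w : ℚ) = e} : Language B) := by
  obtain ⟨m, hm⟩ := exists_abs_le_natCast a
  have hk' : (2 : ℚ) ≤ k := by exact_mod_cast hk
  obtain ⟨M, hM, he⟩ : ∃ M : ℤ, (m : ℤ) ≤ M ∧ |e| ≤ M := ⟨max m |e|, le_max_left _ _,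
    le_max_right _ _⟩
  refine Language.isRegular_of_family (σ := ℚ) (T := (fun z : ℤ => (z : ℚ)) '' Set.Icc (-M) M)
    (fun q => ({w | (intValue k a w : ℚ) = q} : Language B)) ((Set.finite_Icc _ _).image _)
    (fun q x => (q - a x) / k) ?_ ?_ ⟨e, abs_le.1 he, rfl⟩
  · intro q _ x w
    change (intValue k a (x :: w) : ℚ) = q ↔ (intValue k a w : ℚ) = (q - a x) / k
    rw [eq_div_iff (by linarith), intValue]
    push_cast
    constructor <;> intro h <;> linarith
  · rintro _ ⟨z, hz, rfl⟩ x
    by_cases hint : ∃ y : ℤ, (y : ℚ) = (z - a x) / k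
    · obtain ⟨y, hy⟩ := hint
      refine Or.inl ⟨y, abs_le.1 ?_, hy⟩
      have h₁ : (|y| : ℤ) * (k : ℤ) ≤ 2 * M := by
        rw [eq_div_iff (by linarith)] at hy
        have hy' : y * k = z - a x := by exact_mod_cast hy
        calc |y| * (k : ℤ) = |y * k| := by rw [abs_mul, Nat.abs_cast]
          _ = |z - a x| := by rw [hy']
          _ ≤ |z| + |a x| := abs_sub _ _
          _ ≤ 2 * M := by linarith [abs_le.2 hz, hm x]
      have h₂ : |y| * 2 ≤ |y| * (k : ℤ) := by
        have : (2 : ℤ) ≤ k := by exact_mod_cast hk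
        gcongr
      linarith
    · refine Or.inr fun w hw => hint ⟨_, hw⟩

/-- Here reading a digit multiplies the required value by k, so states may escape; but beyond the
bound of `abs_fracValue_le` nothing is accepted. -/
theorem isRegular_fracValue_eq [Finite B] {k : ℕ} (hk : 2 ≤ k) (b : B → ℤ) (e : ℤ) :
    Language.IsRegular ({w | fracValue k b w = e} : Language B) := by
  obtain ⟨m, hm⟩ := exists_abs_le_natCast b
  have hk' : (k : ℚ) ≠ 0 := by positivity
  obtain ⟨M, hM, he⟩ : ∃ M : ℤ, (m : ℤ) ≤ M ∧ |e| ≤ M := ⟨max m |e|, le_max_left _ _,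
    le_max_right _ _⟩
  refine Language.isRegular_of_family (σ := ℤ) (T := Set.Icc (-M) M)
    (fun q => ({w | fracValue k b w = q} : Language B)) (Set.finite_Icc _ _)
    (fun q x => q * k - b x) ?_ ?_ (abs_le.1 he)
  · intro q _ x w
    change fracValue k b (x :: w) = q ↔ fracValue k b w = ((q * k - b x : ℤ) : ℚ)
    rw [fracValue, div_eq_iff hk']
    push_cast
    constructor <;> intro h <;> linarith
  · intro q _ x
    refine or_iff_not_imp_right.2 fun h => ?_
    push Not at h
    obtain ⟨w, hw⟩ := h
    have hle := abs_fracValue_le hk hm w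
    have hw' : fracValue k b w = ((q * k - b x : ℤ) : ℚ) := hw
    rw [hw'] at hle
    have : |q * k - b x| ≤ m := by exact_mod_cast hle
    exact abs_le.1 (this.trans hM)

/-- If the sum vanishes, the fractional value is minus an integer `e`, and its boundedness leaves
finitely many choices of `e`. For each of them the two tracks are checked separately. -/
theorem isRegular_value_eq_zero [Finite B] {k : ℕ} (hk : 2 ≤ k) (a b : B → ℤ) :
    Language.IsRegular ({w | intValue k a w + fracValue k b w = 0} : Language B) := by
  obtain ⟨m, hm⟩ := exists_abs_le_natCast b
  have h := Language.IsRegular.iUnion (ι := Set.Icc (-(m : ℤ)) m) fun e =>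
    (isRegular_intValue_eq hk a e).inf (isRegular_fracValue_eq hk b (-e))
  refine h.congr fun w => ?_
  constructor
  · intro hw
    have hw' : intValue k a w + fracValue k b w = 0 := hw
    have hf : fracValue k b w = ((-intValue k a w : ℤ) : ℚ) := by push_cast; linarith
    have hle := abs_fracValue_le hk hm w
    rw [hf] at hle
    have : |-intValue k a w| ≤ m := by exact_mod_cast hle
    rw [abs_neg] at this
    exact ⟨⟨intValue k a w, abs_le.1 this⟩, rfl, hf⟩
  · rintro ⟨e, h₁, h₂⟩
    have h₁' : (intValue k a w : ℚ) = (e : ℤ) := h₁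
    have h₂' : fracValue k b w = ((-e : ℤ) : ℚ) := h₂
    change intValue k a w + fracValue k b w = 0
    rw [h₁', h₂']
    push_cast
    ring

end Values

/-! ### Balanced digits -/

/-- The digits of the balanced base `k`. -/
abbrev BalancedDigit (k : ℕ) : Type := {d : ℤ // d.bmod k = d}

theorem finite_balancedDigit {k : ℕ} (hk : 0 < k) : Finite (BalancedDigit k) := by
  refine ((Set.finite_Icc (-(k : ℤ)) k).subset fun d hd => ?_).to_subtype
  have hd' : d.bmod k = d := hd
  have h₁ := Int.le_bmod (x := d) hk
  have h₂ := Int.bmod_lt (x := d) hk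
  rw [hd'] at h₁ h₂
  exact ⟨by omega, by omega⟩

/-- The lowest digit is determined by the residue modulo k. -/
theorem intValue_balancedDigit_injective {k : ℕ} (hk : 0 < k) :
    ∀ {v w : List (BalancedDigit k)}, v.length = w.length →
      intValue k Subtype.val v = intValue k Subtype.val w → v = w
  | [], [], _, _ => rfl
  | x :: v, y :: w, hl, h => by
    simp only [intValue] at h
    have hxy : x = y := by
      have := congrArg (Int.bmod · k) h
      simp only [Int.add_mul_bmod_self_left, x.2, y.2] at this
      exact Subtype.ext this
    subst hxy
    have hk' : (k : ℤ) ≠ 0 := by exact_mod_cast hk.ne'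
    rw [intValue_balancedDigit_injective hk (by simpa using hl)
      (mul_left_cancel₀ hk' (add_left_cancel h))]

/-- Balanced division with remainder, by descent on the absolute value. For k = 2 the digits would
be -1 and 0, which represent no positive integer. -/
theorem exists_intValue_balancedDigit {k : ℕ} (hk : 3 ≤ k) (z : ℤ) :
    ∃ w : List (BalancedDigit k), intValue k Subtype.val w = z := by
  induction hn : z.natAbs using Nat.strong_induction_on generalizing z with
  | _ n ih =>
    by_cases hz : z = 0
    · exact ⟨[], hz.symm⟩
    have hdiv := Int.bdiv_add_bmod z k
    have h₁ := Int.le_bmod (x := z) (m := k) (by omega)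
    have h₂ := Int.bmod_lt (x := z) (m := k) (by omega)
    -- Otherwise 2|z|(k - 1) ≤ k, which is impossible for k ≥ 3 and z ≠ 0.
    have hlt : (z.bdiv k).natAbs < n := by
      have hk' : (3 : ℤ) ≤ k := by exact_mod_cast hk
      subst hn
      zify
      have hmul : |z.bdiv k| * (k : ℤ) ≤ |z| + |z.bmod k| := by
        calc |z.bdiv k| * (k : ℤ) = |z.bdiv k * k| := by rw [abs_mul, Nat.abs_cast]
          _ = |z - z.bmod k| := by congr 1; linarith
          _ ≤ _ := abs_sub _ _
      have hmod : |z.bmod k| * 2 ≤ k := by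
        rcases abs_cases (z.bmod k) with h | h <;> omega
      have hz' : 1 ≤ |z| := Int.one_le_abs hz
      by_contra! hge
      nlinarith
    obtain ⟨w, hw⟩ := ih _ hlt (z.bdiv k) rfl
    exact ⟨⟨z.bmod k, Int.bmod_bmod⟩ :: w, by simp only [intValue, hw]; linarith⟩

/-! ### A presentation of `ℤ[1/k]` -/

/-- A letter holds a digit of the integral part and a digit of the fractional part. -/
abbrev DigitPair (k : ℕ) : Type := BalancedDigit k × BalancedDigit k

/-- The pair of zero digits. -/
def zeroPair (k : ℕ) : DigitPair k := (⟨0, Int.zero_bmod⟩, ⟨0, Int.zero_bmod⟩)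

/-- The number `∑ a j * k ^ j + b j / k ^ (j + 1)` represented by a word of pairs `(a j, b j)`. -/
def wordValue (k : ℕ) (w : List (DigitPair k)) : ℚ :=
  intValue k (fun x : DigitPair k => x.1.1) w + fracValue k (fun x : DigitPair k => x.2.1) w

/-- The words without trailing zeros. -/
def normalWords (k : ℕ) : Set (List (DigitPair k)) := {w | w.getLast? ≠ some (zeroPair k)}

theorem finite_digitPair {k : ℕ} (hk : 0 < k) : Finite (DigitPair k) := by
  have := finite_balancedDigit hk
  infer_instance

theorem isRegular_normalWords {k : ℕ} (hk : 0 < k) :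
    Language.IsRegular (normalWords k : Language (DigitPair k)) := by
  have := finite_digitPair hk
  refine (Language.isRegular_of_family (σ := Option (DigitPair k)) (T := Set.univ) (s := none)
    (fun s => ({w | w.getLast?.or s ≠ some (zeroPair k)} : Language (DigitPair k))) Set.finite_univ
    (fun _ x => some x) ?_ (fun _ _ _ => Or.inl trivial) trivial).congr fun w => ?_
  · intro s _ x w
    change (x :: w).getLast?.or s ≠ _ ↔ w.getLast?.or (some x) ≠ _
    rw [List.getLast?_cons]
    cases w.getLast? <;> simp
  · change w.getLast? ≠ _ ↔ w.getLast?.or none ≠ _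
    rw [Option.or_none]

theorem wordValue_append_replicate (k : ℕ) (w : List (DigitPair k)) (m : ℕ) :
    wordValue k (w ++ List.replicate m (zeroPair k)) = wordValue k w := by
  rw [wordValue, intValue_append_replicate k (x := zeroPair k) rfl,
    fracValue_append_replicate k (x := zeroPair k) rfl, wordValue]

/-- Shifting the radix point merges both tracks into one integer expansion, with the reversed
fractional digits at the low end. Uniqueness is thereby reduced to the integers. -/
theorem pow_mul_wordValue {k : ℕ} (hk : k ≠ 0) (w : List (DigitPair k)) :
    (k : ℚ) ^ w.length * wordValue k w =
      intValue k Subtype.val ((w.map Prod.snd).reverse ++ w.map Prod.fst) := by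
  rw [intValue_append, Int.cast_add, intValue_reverse hk, Int.cast_mul, intValue_map,
    fracValue_map, wordValue]
  simp only [List.length_map, List.length_reverse]
  push_cast
  ring

theorem wordValue_injective_of_length_eq {k : ℕ} (hk : 0 < k) {v w : List (DigitPair k)}
    (hl : v.length = w.length) (h : wordValue k v = wordValue k w) : v = w := by
  have h' := pow_mul_wordValue hk.ne' v
  rw [h, hl, pow_mul_wordValue hk.ne' w] at h'
  have := intValue_balancedDigit_injective hk (by simp [hl]) (Int.cast_injective h')
  obtain ⟨h₁, h₂⟩ := List.append_inj this (by simp [hl])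
  rw [← List.zip_unzip v, ← List.zip_unzip w, List.unzip_eq_map, List.unzip_eq_map, ← h₂,
    List.reverse_injective h₁]

theorem eq_of_append_replicate_eq {k : ℕ} {v w : List (DigitPair k)} (hv : v ∈ normalWords k)
    {m m' : ℕ} (hm : m ≤ m')
    (h : v ++ List.replicate m (zeroPair k) = w ++ List.replicate m' (zeroPair k)) : v = w := by
  obtain ⟨d, rfl⟩ := Nat.exists_eq_add_of_le' hm
  rw [List.replicate_add, ← List.append_assoc] at h
  have h' := List.append_cancel_right h
  cases d with
  | zero => simpa using h'
  | succ d =>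
    refine absurd ?_ hv
    rw [h', List.replicate_succ', ← List.append_assoc, List.getLast?_concat]

theorem injOn_wordValue {k : ℕ} (hk : 0 < k) : Set.InjOn (wordValue k) (normalWords k) := by
  intro v hv w hw h
  -- Each word is padded by the length of the other, so that the equal-length case applies.
  have heq : v ++ List.replicate w.length (zeroPair k) =
      w ++ List.replicate v.length (zeroPair k) :=
    wordValue_injective_of_length_eq hk (by simp [add_comm])
      (by rwa [wordValue_append_replicate, wordValue_append_replicate])
  rcases le_total w.length v.length with hl | hl
  · exact eq_of_append_replicate_eq hv hl heq
  · exact (eq_of_append_replicate_eq hw hl heq.symm).symm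

theorem wordValue_mem (k : ℕ) (hk : k ≠ 0) (w : List (DigitPair k)) :
    wordValue k w ∈ integersAdjoinInv k := by
  refine ⟨intValue k Subtype.val ((w.map Prod.snd).reverse ++ w.map Prod.fst), w.length, ?_⟩
  rw [← pow_mul_wordValue hk w]
  have : (k : ℚ) ≠ 0 := by exact_mod_cast hk
  field_simp

theorem exists_wordValue_eq {k : ℕ} (a b : List (BalancedDigit k)) :
    ∃ w, wordValue k w = intValue k Subtype.val a + fracValue k Subtype.val b := by
  let z : BalancedDigit k := ⟨0, Int.zero_bmod⟩
  have hl : (a ++ List.replicate b.length z).length = (b ++ List.replicate a.length z).length := by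
    simp [add_comm]
  refine ⟨(a ++ List.replicate b.length z).zip (b ++ List.replicate a.length z), ?_⟩
  rw [wordValue, ← intValue_map k Prod.fst Subtype.val, ← fracValue_map k Prod.snd Subtype.val,
    List.map_fst_zip hl.le, List.map_snd_zip hl.ge, intValue_append_replicate k (x := z) rfl,
    fracValue_append_replicate k (x := z) rfl]

theorem surjOn_wordValue {k : ℕ} (hk : 3 ≤ k) :
    Set.SurjOn (wordValue k) (normalWords k) (integersAdjoinInv k) := by
  rintro _ ⟨d, l, rfl⟩
  have hk' : (k : ℚ) ≠ 0 := by positivity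
  obtain ⟨e, he⟩ := exists_intValue_balancedDigit hk d
  obtain ⟨w, hw⟩ : ∃ w, wordValue k w = d / (k : ℚ) ^ l := by
    let z : BalancedDigit k := ⟨0, Int.zero_bmod⟩
    -- The padding guarantees at least `l` digits; the lowest `l` of them, reversed, become the
    -- fractional track.
    set e' := e ++ List.replicate l z with he'
    obtain ⟨w, hw⟩ := exists_wordValue_eq (e'.drop l) (e'.take l).reverse
    refine ⟨w, ?_⟩
    have hlen : (e'.take l).length = l := by simp [he']
    have hrev := intValue_reverse (k := k) (by omega) Subtype.val (e'.take l).reverse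
    rw [List.reverse_reverse, List.length_reverse, hlen] at hrev
    have hsum : intValue k Subtype.val (e'.take l ++ e'.drop l) = d := by
      rw [List.take_append_drop, he', intValue_append_replicate k (x := z) rfl, he]
    rw [intValue_append, hlen] at hsum
    rw [hw, eq_div_iff (pow_ne_zero _ hk'), ← hsum]
    push_cast
    rw [hrev]
    ring
  classical
  -- A shortest representing word has no trailing zero, since that could be dropped.
  have hex : ∃ m, ∃ w, w.length = m ∧ wordValue k w = d / (k : ℚ) ^ l := ⟨_, w, rfl, hw⟩
  obtain ⟨v, hv, hvd⟩ := Nat.find_spec hex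
  refine ⟨v, fun hlast => ?_, hvd⟩
  have hne : v ≠ [] := by rintro rfl; simp at hlast
  have hsplit : v = v.dropLast ++ List.replicate 1 (zeroPair k) :=
    (List.dropLast_append_getLast? _ hlast).symm
  refine Nat.find_min hex (m := v.dropLast.length) ?_ ⟨_, rfl, ?_⟩
  · rw [← hv, List.length_dropLast]
    have := List.length_pos_iff.2 hne
    omega
  · rw [← hvd, hsplit, wordValue_append_replicate, ← hsplit]

/-- The padding symbol counts as the digit 0, so the value of a component can be read off the
columns. -/
theorem intValue_convolution {ι B : Type} [Fintype ι] (k : ℕ) (f : B → ℤ) (u : ι → List B) (c : ι) :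
    intValue k (fun x : ι → Option B => (x c).elim 0 f) (convolution u) = intValue k f (u c) := by
  rw [← intValue_map k (fun x : ι → Option B => x c) (fun o => o.elim 0 f), map_convolution,
    intValue_append_replicate k (x := none) rfl, intValue_map]
  rfl

theorem fracValue_convolution {ι B : Type} [Fintype ι] (k : ℕ) (f : B → ℤ) (u : ι → List B)
    (c : ι) :
    fracValue k (fun x : ι → Option B => (x c).elim 0 f) (convolution u) = fracValue k f (u c) := by
  rw [← fracValue_map k (fun x : ι → Option B => x c) (fun o => o.elim 0 f), map_convolution,
    fracValue_append_replicate k (x := none) rfl, fracValue_map]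
  rfl

theorem bijOn_wordValue {k : ℕ} (hk : 3 ≤ k) :
    Set.BijOn (wordValue k) (normalWords k) (integersAdjoinInv k) :=
  ⟨fun w _ => wordValue_mem k (by omega) w, injOn_wordValue (by omega), surjOn_wordValue hk⟩

theorem isFAPresentation_wordValue {k : ℕ} (hk : 3 ≤ k) :
    IsFAPresentation k (normalWords k) (wordValue k) := by
  have := finite_digitPair (k := k) (by omega)
  refine ⟨isRegular_normalWords (by omega), bijOn_wordValue hk, ?_⟩
  let c : Fin 3 → ℤ := ![1, 1, -1]
  convert isFARecognizable_of_isRegular (ι := Fin 3) (fun _ => isRegular_normalWords (k := k)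
    (by omega)) (isRegular_value_eq_zero (k := k) (by omega)
    (fun x : Fin 3 → Option (DigitPair k) => ∑ i, c i * (x i).elim 0 fun y => y.1.1)
    (fun x => ∑ i, c i * (x i).elim 0 fun y => y.2.1)) using 1
  ext u
  refine and_congr Iff.rfl ?_
  change _ ↔ (intValue k _ (convolution u) + fracValue k _ (convolution u) : ℚ) = 0
  rw [intValue_sum, fracValue_sum]
  simp only [intValue_convolution, fracValue_convolution, Fin.sum_univ_three, wordValue, c]
  simp
  constructor <;> intro h <;> linarith

/-! ### Recognizability of right multiplication by a rational matrix -/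

theorem isRegular_range_encodings {P : Type} [Fintype P] {k : ℕ} (hk : 0 < k) :
    Language.IsRegular (convolution '' {u : P → List (DigitPair k) | ∀ p, u p ∈ normalWords k} :
      Language (P → Option (DigitPair k))) := by
  have h := isFARecognizable_of_isRegular (ι := P) (fun _ => isRegular_normalWords hk)
    (isRegular_range_convolution (A := DigitPair k))
  refine h.congr fun w => ?_
  constructor
  · rintro ⟨u, hu, rfl⟩
    exact ⟨u, ⟨hu, ⟨u, rfl⟩⟩, rfl⟩
  · rintro ⟨u, ⟨hu, -⟩, rfl⟩
    exact ⟨u, hu, rfl⟩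

theorem exists_common_denominator {n : ℕ} (g : Matrix (Fin n) (Fin n) ℚ) :
    ∃ (d : ℤ) (h : Fin n → Fin n → ℤ), d ≠ 0 ∧ ∀ i j, (h i j : ℚ) = d * g i j := by
  obtain ⟨d, hd⟩ := IsLocalization.exist_integer_multiples_of_finite (nonZeroDivisors ℤ)
    fun p : Fin n × Fin n => g p.1 p.2
  choose h hh using hd
  exact ⟨d, fun i j => h (i, j), nonZeroDivisors.coe_ne_zero d, fun i j => by simpa using hh (i, j)⟩

/-- With `d` a common denominator of `g` and `h = d g`, each entry of `C * g = D` becomes the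
integer linear condition ∑ₘ h m j · C i m - d · D i j = 0, and regular languages are closed under
finite intersections. -/
theorem isFARecognizable_mul_matrix {n k : ℕ} (hk : 3 ≤ k) (g : Matrix (Fin n) (Fin n) ℚ) :
    IsFARecognizable {u : Fin 2 → List (Fin n × Fin n → Option (DigitPair k)) |
      ∃ C D : Matrix (Fin n) (Fin n) ℚ, EncodesMatrix (normalWords k) (wordValue k) (u 0) C ∧
        EncodesMatrix (normalWords k) (wordValue k) (u 1) D ∧ C * g = D} := by
  have := finite_digitPair (k := k) (by omega)
  obtain ⟨d, h, hd, hh⟩ := exists_common_denominator g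
  let dig (f : DigitPair k → ℤ) (c : Fin 2) (p : Fin n × Fin n)
      (x : Fin 2 → Option (Fin n × Fin n → Option (DigitPair k))) : ℤ :=
    (x c).elim 0 fun y => (y p).elim 0 f
  let form (f : DigitPair k → ℤ) (q : Fin n × Fin n)
      (x : Fin 2 → Option (Fin n × Fin n → Option (DigitPair k))) : ℤ :=
    -- The index `none` stands for the entry of `D`, and `some m` for the `m`-th entry of the row of
    -- `C`.
    ∑ o : Option (Fin n), o.elim (-d) (fun m => h m q.2) *
      o.elim (dig f 1 q) (fun m => dig f 0 (q.1, m)) x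
  have hreg := isFARecognizable_of_isRegular
    (fun _ : Fin 2 => isRegular_range_encodings (P := Fin n × Fin n) (k := k) (by omega))
    (Language.IsRegular.iInter fun q : Fin n × Fin n =>
      isRegular_value_eq_zero (k := k) (by omega) (form (fun y => y.1.1) q)
        (form (fun y => y.2.1) q))
  have key (v : Fin 2 → Fin n × Fin n → List (DigitPair k)) (q : Fin n × Fin n) :
      (intValue k (form (fun y => y.1.1) q) (convolution fun c => convolution (v c)) +
        fracValue k (form (fun y => y.2.1) q) (convolution fun c => convolution (v c)) : ℚ) =
      d * (∑ m, wordValue k (v 0 (q.1, m)) * g m q.2 - wordValue k (v 1 q)) := by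
    have hi (f : DigitPair k → ℤ) :
        intValue k (form f q) (convolution fun c => convolution (v c)) =
          -d * intValue k f (v 1 q) + ∑ m, h m q.2 * intValue k f (v 0 (q.1, m)) := by
      refine (intValue_sum Finset.univ k _ _ _).trans ?_
      simp only [Fintype.sum_option, Option.elim_none, Option.elim_some, dig]
      simp only [intValue_convolution k (B := Fin n × Fin n → Option (DigitPair k)),
        intValue_convolution]
    have hf (f : DigitPair k → ℤ) :
        fracValue k (form f q) (convolution fun c => convolution (v c)) =
          -d * fracValue k f (v 1 q) + ∑ m, h m q.2 * fracValue k f (v 0 (q.1, m)) := by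
      refine (fracValue_sum Finset.univ k _ _ _).trans ?_
      simp only [Fintype.sum_option, Option.elim_none, Option.elim_some, dig]
      simp only [fracValue_convolution k (B := Fin n × Fin n → Option (DigitPair k)),
        fracValue_convolution, Int.cast_neg]
    have hm (m : Fin n) : (d : ℚ) * (wordValue k (v 0 (q.1, m)) * g m q.2) =
        h m q.2 * intValue k (fun y : DigitPair k => y.1.1) (v 0 (q.1, m)) +
        h m q.2 * fracValue k (fun y : DigitPair k => y.2.1) (v 0 (q.1, m)) := by
      rw [hh, wordValue]; ring
    rw [hi, hf, mul_sub, Finset.mul_sum]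
    simp only [hm, Finset.sum_add_distrib]
    rw [wordValue]
    push_cast
    ring
  have hd' : (d : ℚ) ≠ 0 := by exact_mod_cast hd
  convert hreg using 1
  ext u
  constructor
  · rintro ⟨C, D, ⟨v₀, h₀, hC, hu₀⟩, ⟨v₁, h₁, hD, hu₁⟩, hCD⟩
    have hu : u = fun c => convolution ((![v₀, v₁] : Fin 2 → _) c) :=
      funext fun c => by fin_cases c <;> simpa
    refine ⟨fun c => ?_, fun q => ?_⟩
    · fin_cases c
      · exact ⟨v₀, h₀, hu₀.symm⟩
      · exact ⟨v₁, h₁, hu₁.symm⟩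
    · rw [hu]
      refine (key _ q).trans ?_
      rw [mul_eq_zero, sub_eq_zero]
      right
      simp [hC, hD, ← hCD, Matrix.mul_apply]
  · rintro ⟨hL, hK⟩
    choose v hv huv using hL
    refine ⟨.of fun i j => wordValue k (v 0 (i, j)), .of fun i j => wordValue k (v 1 (i, j)),
      ⟨v 0, hv 0, fun _ _ => rfl, (huv 0).symm⟩, ⟨v 1, hv 1, fun _ _ => rfl, (huv 1).symm⟩, ?_⟩
    ext i j
    have := hK (i, j)
    change (intValue k _ _ + fracValue k _ _ : ℚ) = 0 at this
    rw [show u = fun c => convolution (v c) from funext fun c => (huv c).symm, key, mul_eq_zero,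
      sub_eq_zero] at this
    rw [Matrix.mul_apply]
    exact this.resolve_left hd'

/-! ### Two-pass machines -/

theorem update_getElem?_append_cons {B : Type*} (P r : List B) (c c' d : B) :
    Function.update (fun i => (P ++ c :: r)[i]?.getD d) P.length c' =
      fun i => (P ++ c' :: r)[i]?.getD d := by
  funext i
  rcases lt_trichotomy i P.length with h | rfl | h
  · rw [Function.update_of_ne h.ne, List.getElem?_append_left h, List.getElem?_append_left h]
  · simp
  · rw [Function.update_of_ne h.ne', List.getElem?_append_right h.le,
      List.getElem?_append_right h.le]
    obtain ⟨j, hj⟩ := Nat.exists_eq_add_of_lt h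
    rw [show i - P.length = j + 1 by omega]
    rfl

theorem PFMachine.tapeOf_eq {A : Type} (M : PFMachine A) (x : List A) :
    M.tapeOf x = fun i => (x.map PFCell.letter)[i]?.getD .blank := by
  funext i
  rw [List.getElem?_map, PFMachine.tapeOf]
  cases x[i]? <;> rfl

section TwoPass

/-- The cell holding a letter or a blank. -/
def PFCell.ofOption {A W : Type} : Option A → PFCell A W
  | none => .blank
  | some a => .letter a

/-- States of a machine which scans the input to its end, appends a word, and scans back. -/
inductive TwoPassState (A S T : Type) (m : ℕ) : Type where
  | forward (s : S)
  | extend (t : T) (l : {l : List (Option A) // l.length ≤ m})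
  | back (t : T)
  | done

variable {A S T : Type}

theorem finite_twoPassState [Finite A] [Finite S] [Finite T] (m : ℕ) :
    Finite (TwoPassState A S T m) := by
  have : Finite {l : List (Option A) // l.length ≤ m} :=
    (List.finite_length_le (Option A) m).to_subtype
  refine Finite.of_injective (β := S ⊕ (T × {l : List (Option A) // l.length ≤ m}) ⊕ T ⊕ Unit)
    (fun
      | .forward s => .inl s
      | .extend t l => .inr (.inl (t, l))
      | .back t => .inr (.inr (.inl t))
      | .done => .inr (.inr (.inr ()))) ?_
  rintro (_ | _ | _ | _) (_ | _ | _ | _) h <;> simp_all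

/-- The data of a two-pass machine: a left-to-right automaton, whose states are stored along the
input, a finite word to be written at the end of the input, and a right-to-left transducer. -/
structure TwoPass (A S T : Type) where
  start : S
  next : S → A → S
  turn : S → T
  bound : ℕ
  tail : S → {l : List (Option A) // l.length ≤ bound}
  prev : T → A × S → T
  out : T → A × S → Option A

namespace TwoPass

variable (D : TwoPass A S T)

/-- The transition function on cells. -/
def trans : TwoPassState A S T D.bound → PFCell A (A × S) →
    TwoPassState A S T D.bound × PFCell A (A × S) × PFMove
  | .forward s, .letter a => (.forward (D.next s a), .work (a, s), .right)
  | .forward s, c => (.extend (D.turn s) (D.tail s), c, .stay)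
  | .extend t ⟨o :: l, h⟩, _ => (.extend t ⟨l, (Nat.le_succ _).trans h⟩, .ofOption o, .right)
  -- This cell lies just beyond the appended word and is already blank.
  | .extend t ⟨[], _⟩, _ => (.back t, .blank, .left)
  | .back t, .work x => (.back (D.prev t x), .ofOption (D.out t x), .left)
  | .back t, c => (.back t, c, .left)
  | .done, c => (.done, c, .stay)

/-- The machine that carries out both passes. -/
def machine [Finite A] [Finite S] [Finite T] : PFMachine A where
  State := TwoPassState A S T D.bound
  Work := A × S
  finite_state := finite_twoPassState _
  finite_work := inferInstance
  start := .forward D.start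
  accept
    | .done => true
    | _ => false
  atMarker
    | .forward s => (.forward s, true)
    | _ => (.done, false)
  atCell := D.trans

/-- The input together with the states of the first pass. -/
def annotate (D : TwoPass A S T) : S → List A → List (A × S)
  | _, [] => []
  | s, a :: x => (a, s) :: annotate D (D.next s a) x

/-- The effect of the second pass on the annotated input, starting from a state and from the word
to the right of the input. -/
def backward (p : T × List (Option A)) (w : List (A × S)) : T × List (Option A) :=
  w.foldr (fun x p => (D.prev p.1 x, D.out p.1 x :: p.2)) p

/-- The output, possibly followed by blanks. -/
def result (x : List A) : List (Option A) :=
  (D.backward (D.turn (x.foldl D.next D.start), (D.tail (x.foldl D.next D.start)).1)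
    (D.annotate D.start x)).2

theorem length_annotate (s : S) (x : List A) : (D.annotate s x).length = x.length := by
  induction x generalizing s with
  | nil => rfl
  | cons a x ih => simp [annotate, ih]

variable [Finite A] [Finite S] [Finite T]

/-- The configuration whose tape holds a list of cells followed by blanks. -/
def config (q : TwoPassState A S T D.bound) (h : ℕ) (l : List (PFCell A (A × S))) :
    D.machine.Config :=
  ⟨q, h, fun i => l[i]?.getD .blank⟩

theorem step_cell {q : TwoPassState A S T D.bound} (hq : q ≠ .done)
    (P r : List (PFCell A (A × S))) (c : PFCell A (A × S)) :
    D.machine.step (D.config q (P.length + 1) (P ++ c :: r)) =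
      D.config (D.trans q c).1
        (match (D.trans q c).2.2 with
          | .left => P.length
          | .stay => P.length + 1
          | .right => P.length + 2)
        (P ++ (D.trans q c).2.1 :: r) := by
  have hacc : ¬ D.machine.accept q = true := by cases q <;> simp_all [machine]
  have hc : (P ++ c :: r)[P.length]?.getD .blank = c := by simp
  simp only [config, PFMachine.step, if_neg hacc, hc]
  exact congrArg _ (update_getElem?_append_cons P r c _ _)

/-- Makes the first blank beyond the list explicit, so that `step_cell` applies there. -/
theorem config_append_blank (q : TwoPassState A S T D.bound) (h : ℕ)
    (l : List (PFCell A (A × S))) : D.config q h (l ++ [.blank]) = D.config q h l := by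
  simp only [config]
  congr 1
  funext i
  rcases lt_trichotomy i l.length with hi | rfl | hi
  · rw [List.getElem?_append_left hi]
  · simp
  · rw [List.getElem?_eq_none (by simpa using hi), List.getElem?_eq_none hi.le]

theorem iterate_forward (x : List A) (s : S) (P : List (PFCell A (A × S))) :
    D.machine.step^[x.length] (D.config (.forward s) (P.length + 1) (P ++ x.map .letter)) =
      D.config (.forward (x.foldl D.next s)) (P.length + x.length + 1)
        (P ++ (D.annotate s x).map .work) := by
  induction x generalizing s P with
  | nil => rfl
  | cons a x ih =>
    rw [List.length_cons, Function.iterate_succ_apply, List.map_cons, D.step_cell (by simp)]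
    have := ih (D.next s a) (P ++ [.work (a, s)])
    simp only [List.length_append, List.length_singleton, List.append_assoc,
      List.singleton_append] at this
    refine this.trans ?_
    rw [show P.length + 1 + x.length + 1 = P.length + (x.length + 1) + 1 by ring]
    rfl

theorem iterate_extend (t : T) (l : {l : List (Option A) // l.length ≤ D.bound})
    (P : List (PFCell A (A × S))) :
    D.machine.step^[l.1.length + 1] (D.config (.extend t l) (P.length + 1) P) =
      D.config (.back t) (P.length + l.1.length) (P ++ l.1.map .ofOption) := by
  obtain ⟨l, hl⟩ := l
  induction l generalizing P with
  | nil =>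
    rw [← config_append_blank]
    exact (D.step_cell (q := .extend t ⟨[], hl⟩) (by simp) P [] .blank).trans
      ((D.config_append_blank _ _ P).trans (by simp; rfl))
  | cons o l ih =>
    rw [← config_append_blank, Function.iterate_succ_apply, D.step_cell (by simp)]
    have := ih (P ++ [.ofOption o]) ((Nat.le_succ _).trans hl)
    simp only [List.length_append, List.length_singleton, List.append_assoc,
      List.singleton_append] at this
    refine this.trans ?_
    rw [show P.length + 1 + l.length = P.length + (l.length + 1) by ring]
    rfl

theorem iterate_back_letters (t : T) (P : List (PFCell A (A × S))) (l : List (Option A)) :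
    ∀ r, D.machine.step^[l.length]
      (D.config (.back t) (P.length + l.length) (P ++ l.map .ofOption ++ r)) =
      D.config (.back t) P.length (P ++ l.map .ofOption ++ r) := by
  induction l using List.reverseRecOn with
  | nil => exact fun _ => rfl
  | append_singleton l o ih =>
    intro r
    have h := D.step_cell (q := .back t) (by simp) (P ++ l.map .ofOption) r (.ofOption o)
    have hcell : D.trans (.back t) (.ofOption o) = (.back t, .ofOption o, .left) := by
      cases o <;> rfl
    rw [hcell] at h
    simp only [List.length_append, List.length_map] at h
    have h' := ih (.ofOption o :: r)
    simp only [List.length_append, List.length_singleton, List.map_append, List.map_cons,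
      List.map_nil, List.append_assoc, List.singleton_append] at h h' ⊢
    rw [Function.iterate_succ_apply, ← add_assoc, h, h']

theorem iterate_backward (w : List (A × S)) (t : T) (l : List (Option A)) :
    D.machine.step^[w.length]
      (D.config (.back t) w.length (w.map .work ++ l.map .ofOption)) =
      D.config (.back (D.backward (t, l) w).1) 0
        ((D.backward (t, l) w).2.map .ofOption) := by
  induction w using List.reverseRecOn generalizing t l with
  | nil => rfl
  | append_singleton w x ih =>
    have h := D.step_cell (q := .back t) (by simp) (w.map .work) (l.map .ofOption) (.work x)
    have h' := ih (D.prev t x) (D.out t x :: l)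
    simp only [List.length_append, List.length_singleton, List.map_append, List.map_cons,
      List.map_nil, List.append_assoc, List.singleton_append, List.length_map] at h h' ⊢
    rw [Function.iterate_succ_apply, h]
    refine h'.trans ?_
    simp only [backward, List.foldr_append, List.foldr_cons, List.foldr_nil]

/-- The machine halts in linear time, with the result on its tape. -/
theorem exists_run_eq (x : List A) : ∃ t ≤ (2 * D.bound + 4) * (x.length + 1),
    D.machine.run x t = D.config .done 0 ((D.result x).map .ofOption) := by
  set s := x.foldl D.next D.start with hs
  set w := D.annotate D.start x with hw
  have hwl : w.length = x.length := D.length_annotate _ _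
  have h₀ : D.machine.step^[1] (D.machine.init x) =
      D.config (.forward D.start) 1 (x.map .letter) := by
    rw [Function.iterate_one, PFMachine.init, PFMachine.tapeOf_eq]
    rfl
  have h₁ : D.machine.step^[x.length] (D.config (.forward D.start) 1 (x.map .letter)) =
      D.config (.forward s) (w.length + 1) (w.map .work) := by
    simpa [hwl] using D.iterate_forward x D.start []
  have h₂ : D.machine.step^[1] (D.config (.forward s) (w.length + 1) (w.map .work)) =
      D.config (.extend (D.turn s) (D.tail s)) (w.length + 1) (w.map .work) := by
    rw [← config_append_blank, ← D.config_append_blank (.extend (D.turn s) (D.tail s))]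
    have := D.step_cell (q := .forward s) (by simp) (w.map .work) [] .blank
    rw [List.length_map] at this
    exact this
  have h₃ := D.iterate_extend (D.turn s) (D.tail s) (w.map .work)
  have h₄ := D.iterate_back_letters (D.turn s) (w.map .work) (D.tail s).1 []
  have h₅ := D.iterate_backward w (D.turn s) (D.tail s).1
  have h₆ : D.machine.step^[1] (D.config (.back (D.backward (D.turn s, (D.tail s).1) w).1) 0
      ((D.result x).map .ofOption)) = D.config .done 0 ((D.result x).map .ofOption) := by
    simp [config, PFMachine.step, machine]
  rw [List.append_nil] at h₄
  rw [List.length_map] at h₃ h₄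
  -- From right to left: leaving the marker, the forward pass, the switch at the first blank,
  -- writing the tail and turning, returning over the tail, the backward pass, and halting on the
  -- marker.
  refine ⟨1 + (w.length + ((D.tail s).1.length + (((D.tail s).1.length + 1) +
    (1 + (x.length + 1))))), ?_, ?_⟩
  · have := (D.tail s).2
    rw [hwl]
    nlinarith [Nat.zero_le (D.bound * x.length)]
  · rw [PFMachine.run]
    simp only [Function.iterate_add_apply _ _ _ (D.machine.init x)]
    rw [h₀, h₁, h₂, h₃, h₄, h₅]
    exact h₆

theorem isPFLinearTimeComputable {f : List A → List A}
    (hf : ∀ (x : List A) (i : ℕ), (D.result x)[i]?.getD none = (f x)[i]?) : IsPFLinearTimeComputable f := by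
  refine ⟨D.machine, 2 * D.bound + 4, fun x => ?_⟩
  obtain ⟨t, ht, hrun⟩ := D.exists_run_eq x
  refine ⟨t, ht, by rw [hrun]; rfl, fun i _ => ?_⟩
  rw [hrun]
  simp only [config, PFMachine.tapeOf, ← hf, List.getElem?_map]
  rcases (D.result x)[i]? with _ | _ | _ <;> rfl

end TwoPass

end TwoPass

/-! ### Functions with a recognizable graph -/

section Graph

variable {A σ : Type} (M : DFA (Fin 2 → Option A) σ)

/-- The states reachable by reading a column whose upper entry is `a`. -/
def graphNext (Q : Set σ) (a : A) : Set σ := {q | ∃ p ∈ Q, ∃ c, c 0 = some a ∧ M.step p c = q}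

/-- An accepting state can be reached by reading columns with empty upper entries. -/
def GraphTail (Q : Set σ) (z : σ × List (Fin 2 → Option A)) : Prop :=
  z.1 ∈ Q ∧ (∀ c ∈ z.2, c 0 = none) ∧ M.evalFrom z.1 z.2 ∈ M.accept

/-- A state in `x.2` and a column with upper entry `x.1` leading to the state `q`. -/
def GraphPrev (q : σ) (x : A × Set σ) (z : σ × (Fin 2 → Option A)) : Prop :=
  z.1 ∈ x.2 ∧ z.2 0 = some x.1 ∧ M.step z.1 z.2 = q

theorem evalFrom_mem_foldl_graphNext {x : List A} {Q : Set σ} {q : σ} (hq : q ∈ Q)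
    {W : List (Fin 2 → Option A)} (hW : W.map (· 0) = x.map some) :
    M.evalFrom q W ∈ x.foldl (graphNext M) Q := by
  induction x generalizing Q q W with
  | nil =>
    obtain rfl : W = [] := by simpa using hW
    exact hq
  | cons a x ih =>
    obtain ⟨c, W, rfl, hc, hW'⟩ := List.map_eq_cons_iff.1 hW
    exact ih (Q := graphNext M Q a) (q := M.step q c) ⟨q, hq, c, hc, rfl⟩ hW'

open Classical in
/-- The word written at the end of the input if the states in `Q` are reachable there. -/
noncomputable def graphTailWord (Q : Set σ) : List (Option A) :=
  if h : ∃ z, GraphTail M Q z then h.choose.2.map (· 1) else []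

/-- There are only finitely many sets of states, and one tail has been chosen for each. -/
theorem exists_length_graphTailWord_le [Finite σ] :
    ∃ m, ∀ Q : Set σ, (graphTailWord M Q).length ≤ m := by
  obtain ⟨m, hm⟩ := exists_abs_le_natCast fun Q : Set σ => ((graphTailWord M Q).length : ℤ)
  exact ⟨m, fun Q => by exact_mod_cast hm Q⟩

open Classical in
/-- The two-pass machine that finds, for a word `x`, the columns of an accepted word with first
component `x`. -/
noncomputable def graphTwoPass [Finite σ] : TwoPass A (Set σ) (Option σ) where
  start := {M.start}
  next := graphNext M
  turn Q := if h : ∃ z, GraphTail M Q z then some h.choose.1 else none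
  bound := (exists_length_graphTailWord_le M).choose
  tail Q := ⟨graphTailWord M Q, (exists_length_graphTailWord_le M).choose_spec Q⟩
  prev t x := t.bind fun q => if h : ∃ z, GraphPrev M q x z then some h.choose.1 else none
  out t x := t.bind fun q => if h : ∃ z, GraphPrev M q x z then h.choose.2 1 else none

variable [Finite σ]

theorem backward_graphTwoPass_none (w : List (A × Set σ)) (l : List (Option A)) :
    (graphTwoPass M).backward (none, l) w = (none, List.replicate w.length none ++ l) := by
  induction w with
  | nil => rfl
  | cons x w ih =>
    rw [TwoPass.backward] at ih ⊢
    rw [List.foldr_cons, ih]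
    rfl

/-- Every predecessor is chosen inside the reachable set stored at its cell, so the search backwards
never gets stuck and ends at a state of `Q`. -/
theorem backward_graphTwoPass_some (x : List A) {Q : Set σ} {q : σ}
    (hq : q ∈ x.foldl (graphNext M) Q) (l : List (Option A)) :
    ∃ p ∈ Q, ∃ W : List (Fin 2 → Option A), W.map (· 0) = x.map some ∧ M.evalFrom p W = q ∧
      (graphTwoPass M).backward (some q, l) ((graphTwoPass M).annotate Q x) =
        (some p, W.map (· 1) ++ l) := by
  induction x generalizing Q with
  | nil => exact ⟨q, hq, [], rfl, rfl, rfl⟩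
  | cons a x ih =>
    obtain ⟨p', hp', W, hW, hev, hback⟩ := ih hq
    have hex : ∃ z, GraphPrev M p' (a, Q) z := by
      obtain ⟨p, hp, c, hc⟩ := hp'
      exact ⟨(p, c), hp, hc⟩
    obtain ⟨h₁, h₂, h₃⟩ := hex.choose_spec
    refine ⟨hex.choose.1, h₁, hex.choose.2 :: W, by simp [h₂, hW], ?_, ?_⟩
    · rw [DFA.evalFrom_cons, h₃, hev]
    · rw [TwoPass.backward] at hback ⊢
      rw [TwoPass.annotate, List.foldr_cons]
      have hn : (graphTwoPass M).next Q a = graphNext M Q a := rfl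
      rw [hn, hback]
      simp [graphTwoPass, hex]

/-- The result is determined by an accepted word with first component `x`, if there is one. -/
theorem result_graphTwoPass (x : List A) :
    (∃ W ∈ M.accepts, W.filterMap (· 0) = x ∧ (graphTwoPass M).result x = W.map (· 1)) ∨
      ((∀ W₁ W₂, W₁.map (· 0) = x.map some → (∀ c ∈ W₂, c 0 = none) → W₁ ++ W₂ ∉ M.accepts) ∧
        ∀ i : ℕ, ((graphTwoPass M).result x)[i]?.getD none = none) := by
  classical
  set Q := x.foldl (graphNext M) {M.start} with hQ
  by_cases h : ∃ z, GraphTail M Q z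
  · left
    obtain ⟨h₁, h₂, h₃⟩ := h.choose_spec
    obtain ⟨p, rfl, W, hW, hev, hback⟩ := backward_graphTwoPass_some M x h₁ (h.choose.2.map (· 1))
    refine ⟨W ++ h.choose.2, ?_, ?_, ?_⟩
    · rw [DFA.mem_accepts, DFA.eval, DFA.evalFrom_of_append, hev]
      exact h₃
    · have e₁ : W.filterMap (· 0) = x := by
        have : W.filterMap (· 0) = (W.map (· 0)).filterMap id := by rw [List.filterMap_map]; rfl
        rw [this, hW]
        simp [List.filterMap_map]
      rw [List.filterMap_append, e₁, List.filterMap_eq_nil_iff.2 h₂, List.append_nil]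
    · have hres : (graphTwoPass M).result x = ((graphTwoPass M).backward
          (some h.choose.1, h.choose.2.map (· 1)) ((graphTwoPass M).annotate {M.start} x)).2 := by
        have ht : (graphTwoPass M).turn Q = some h.choose.1 := dif_pos h
        have hl : ((graphTwoPass M).tail Q).1 = h.choose.2.map (· 1) := dif_pos h
        rw [← ht, ← hl]
        rfl
      rw [hres, hback, List.map_append]
  · right
    constructor
    · intro W₁ W₂ h₁ h₂ hacc
      refine h ⟨(M.evalFrom M.start W₁, W₂),
        evalFrom_mem_foldl_graphNext M (Set.mem_singleton _) h₁, h₂, ?_⟩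
      rwa [DFA.mem_accepts, DFA.eval, DFA.evalFrom_of_append] at hacc
    · intro i
      have hres : (graphTwoPass M).result x = ((graphTwoPass M).backward (none, [])
          ((graphTwoPass M).annotate {M.start} x)).2 := by
        have ht : (graphTwoPass M).turn Q = none := dif_neg h
        have hl : ((graphTwoPass M).tail Q).1 = [] := dif_neg h
        rw [← ht, ← hl]
        rfl
      rw [hres, backward_graphTwoPass_none, List.append_nil, List.getElem?_replicate]
      split_ifs <;> rfl

end Graph

/-- A partial function with a recognizable graph extends to a function computed in linear time by
a position-faithful machine. -/
theorem exists_isPFLinearTimeComputable {A : Type} [Finite A] {R : Set (Fin 2 → List A)}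
    (hR : IsFARecognizable R) (hfun : ∀ u ∈ R, ∀ v ∈ R, u 0 = v 0 → u 1 = v 1) :
    ∃ f : List A → List A, IsPFLinearTimeComputable f ∧ ∀ u ∈ R, f (u 0) = u 1 := by
  classical
  obtain ⟨σ, _, M, hM⟩ := hR
  -- Outside the domain of the relation the machine leaves only blanks, hence the default `[]`.
  let f (x : List A) : List A := if h : ∃ u ∈ R, u 0 = x then h.choose 1 else []
  have hf (u) (hu : u ∈ R) : f (u 0) = u 1 := by
    have h : ∃ v ∈ R, v 0 = u 0 := ⟨u, hu, rfl⟩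
    simp only [f, dif_pos h]
    exact hfun _ h.choose_spec.1 _ hu h.choose_spec.2
  refine ⟨f, (graphTwoPass M).isPFLinearTimeComputable fun x i => ?_, hf⟩
  rcases result_graphTwoPass M x with ⟨W, hW, hx, hres⟩ | ⟨hno, hres⟩
  · rw [hM] at hW
    obtain ⟨u, hu, rfl⟩ := hW
    rw [filterMap_convolution] at hx
    subst hx
    rw [hf u hu, hres, ← getElem?_convolution u 1 i, List.getElem?_map]
    cases (convolution u)[i]? <;> rfl
  · have h : ¬ ∃ u ∈ R, u 0 = x := by
      rintro ⟨u, hu, rfl⟩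
      have hmap := map_convolution u 0
      -- The convolution is cut where its first component ends, which gives an accepted word of the
      -- excluded form.
      obtain ⟨W₁, W₂, hW, h₁, h₂⟩ := List.map_eq_append_iff.1 hmap
      refine hno W₁ W₂ h₁ (fun c hc => ?_) (hW ▸ hM ▸ ⟨u, hu, rfl⟩)
      exact List.eq_of_mem_replicate (h₂ ▸ List.mem_map_of_mem hc)
    rw [hres]
    simp [f, dif_neg h]

/-! ### Groups of matrices with entries in `ℤ[1/k]` -/

theorem zero_mem_integersAdjoinInv (k : ℕ) : (0 : ℚ) ∈ integersAdjoinInv k := ⟨0, 0, by simp⟩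

theorem one_mem_integersAdjoinInv (k : ℕ) : (1 : ℚ) ∈ integersAdjoinInv k := ⟨1, 0, by simp⟩

theorem add_mem_integersAdjoinInv {k : ℕ} (hk : k ≠ 0) {x y : ℚ} (hx : x ∈ integersAdjoinInv k)
    (hy : y ∈ integersAdjoinInv k) : x + y ∈ integersAdjoinInv k := by
  obtain ⟨d, l, rfl⟩ := hx
  obtain ⟨e, m, rfl⟩ := hy
  have hk' : (k : ℚ) ≠ 0 := by exact_mod_cast hk
  refine ⟨d * k ^ m + e * k ^ l, l + m, ?_⟩
  push_cast
  field_simp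
  ring

theorem mul_mem_integersAdjoinInv {k : ℕ} {x y : ℚ} (hx : x ∈ integersAdjoinInv k)
    (hy : y ∈ integersAdjoinInv k) : x * y ∈ integersAdjoinInv k := by
  obtain ⟨d, l, rfl⟩ := hx
  obtain ⟨e, m, rfl⟩ := hy
  exact ⟨d * e, l + m, by push_cast; rw [div_mul_div_comm, pow_add]⟩

theorem sum_mem_integersAdjoinInv {k : ℕ} (hk : k ≠ 0) {ι : Type*} (s : Finset ι) {f : ι → ℚ}
    (hf : ∀ i, f i ∈ integersAdjoinInv k) : ∑ i ∈ s, f i ∈ integersAdjoinInv k := by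
  classical
  induction s using Finset.induction_on with
  | empty => exact zero_mem_integersAdjoinInv k
  | insert i s hi ih =>
    rw [Finset.sum_insert hi]
    exact add_mem_integersAdjoinInv hk (hf i) ih

theorem mem_integersAdjoinInv_of_den_dvd {k : ℕ} (hk : k ≠ 0) {x : ℚ} (hx : x.den ∣ k) :
    x ∈ integersAdjoinInv k := by
  obtain ⟨m, rfl⟩ := hx
  refine ⟨x.num * m, 1, ?_⟩
  have hm : (m : ℚ) ≠ 0 := by
    rintro h
    simp_all
  push_cast
  rw [pow_one, mul_div_mul_right _ _ hm, Rat.num_div_den]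

theorem mul_entries_mem {n k : ℕ} (hk : k ≠ 0) {C D : Matrix (Fin n) (Fin n) ℚ}
    (hC : ∀ i j, C i j ∈ integersAdjoinInv k) (hD : ∀ i j, D i j ∈ integersAdjoinInv k) (i j : Fin n) :
    (C * D) i j ∈ integersAdjoinInv k := by
  rw [Matrix.mul_apply]
  exact sum_mem_integersAdjoinInv hk _ fun m => mul_mem_integersAdjoinInv (hC i m) (hD m j)

theorem exists_entries_mem_integersAdjoinInv {n : ℕ}
    {G : Subgroup (Matrix.GeneralLinearGroup (Fin n) ℚ)} (hG : G.FG) :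
    ∃ k, 3 ≤ k ∧ ∀ g ∈ G, ∀ i j, (g : Matrix (Fin n) (Fin n) ℚ) i j ∈ integersAdjoinInv k := by
  obtain ⟨S, rfl⟩ := hG
  let den (g : Matrix.GeneralLinearGroup (Fin n) ℚ) (i j : Fin n) : ℕ :=
    ((g : Matrix (Fin n) (Fin n) ℚ) i j).den
  let m : ℕ := ∏ g ∈ S, ∏ i, ∏ j, den g i j * den g⁻¹ i j
  have hdvd (g) (hg : g ∈ S) (i j) : den g i j * den g⁻¹ i j ∣ m :=
    (((Finset.dvd_prod_of_mem (fun j => den g i j * den g⁻¹ i j) (Finset.mem_univ j)).trans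
      (Finset.dvd_prod_of_mem (fun i => ∏ j, den g i j * den g⁻¹ i j) (Finset.mem_univ i))).trans
      (Finset.dvd_prod_of_mem (fun g => ∏ i, ∏ j, den g i j * den g⁻¹ i j) hg))
  have hm : 0 < m := Finset.prod_pos fun g _ => Finset.prod_pos fun i _ => Finset.prod_pos
    fun j _ => Nat.mul_pos (Rat.den_pos _) (Rat.den_pos _)
  have hk : 3 * m ≠ 0 := by omega
  -- The factor 3 secures k ≥ 3, as balanced digits require.
  refine ⟨3 * m, by omega, fun g hg => ?_⟩
  -- The entries of an inverse are not controlled by those of the matrix alone, because of the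
  -- determinant, so both are carried through the induction.
  suffices h : (∀ i j, (g : Matrix (Fin n) (Fin n) ℚ) i j ∈ integersAdjoinInv (3 * m)) ∧
      ∀ i j, ((g⁻¹ : Matrix.GeneralLinearGroup (Fin n) ℚ) : Matrix (Fin n) (Fin n) ℚ) i j ∈
        integersAdjoinInv (3 * m) from h.1
  induction hg using Subgroup.closure_induction with
  | mem g hg =>
    refine ⟨fun i j => mem_integersAdjoinInv_of_den_dvd hk ?_,
      fun i j => mem_integersAdjoinInv_of_den_dvd hk ?_⟩
    · exact ((dvd_mul_right _ _).trans (hdvd g hg i j)).mul_left 3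
    · exact ((dvd_mul_left _ _).trans (hdvd g hg i j)).mul_left 3
  | one =>
    rw [inv_one, and_self]
    intro i j
    rw [Units.val_one, Matrix.one_apply]
    split_ifs
    · exact one_mem_integersAdjoinInv _
    · exact zero_mem_integersAdjoinInv _
  | mul g h _ _ hg hh =>
    rw [mul_inv_rev, Units.val_mul, Units.val_mul]
    exact ⟨mul_entries_mem hk hg.1 hh.1, mul_entries_mem hk hh.2 hg.2⟩
  | inv g _ hg =>
    rw [inv_inv]
    exact hg.symm

/-! ### Encodings of matrices -/

section Encodings

variable {n k : ℕ} {A : Type} {L₁ : Set (List A)} {φ : List A → ℚ}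

theorem EncodesMatrix.matrix_unique {w : List (Fin n × Fin n → Option A)}
    {C D : Matrix (Fin n) (Fin n) ℚ} (hC : EncodesMatrix L₁ φ w C) (hD : EncodesMatrix L₁ φ w D) :
    C = D := by
  obtain ⟨u, -, hu, rfl⟩ := hC
  obtain ⟨v, -, hv, huv⟩ := hD
  obtain rfl := convolution_injective huv
  ext i j
  rw [← hu, hv]

theorem EncodesMatrix.word_unique (hφ : Set.InjOn φ L₁)
    {v w : List (Fin n × Fin n → Option A)} {C : Matrix (Fin n) (Fin n) ℚ}
    (hv : EncodesMatrix L₁ φ v C) (hw : EncodesMatrix L₁ φ w C) : v = w := by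
  obtain ⟨s, hs, hsC, rfl⟩ := hv
  obtain ⟨t, ht, htC, rfl⟩ := hw
  congr 1
  funext p
  exact hφ (hs p) (ht p) ((hsC p.1 p.2).trans (htC p.1 p.2).symm)

theorem exists_encodesMatrix (hφ : Set.SurjOn φ L₁ (integersAdjoinInv k))
    {C : Matrix (Fin n) (Fin n) ℚ} (hC : ∀ i j, C i j ∈ integersAdjoinInv k) :
    ∃ w, EncodesMatrix L₁ φ w C := by
  choose u hu huC using fun p : Fin n × Fin n => hφ (hC p.1 p.2)
  exact ⟨convolution u, u, hu, fun i j => huC (i, j), rfl⟩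

/-- If right multiplication by each element of `G` is recognizable, then the encodings of the
elements of `G` form a Cayley position-faithful linear-time computable representation. -/
theorem isCayleyPFLinearTimeRepresentation_of_isFARecognizable [Finite A]
    {G : Subgroup (Matrix.GeneralLinearGroup (Fin n) ℚ)}
    (hφ : Set.BijOn φ L₁ (integersAdjoinInv k))
    (hent : ∀ g ∈ G, ∀ i j, (g : Matrix (Fin n) (Fin n) ℚ) i j ∈ integersAdjoinInv k)
    (hrec : ∀ g ∈ G, IsFARecognizable
      {u : Fin 2 → List (Fin n × Fin n → Option A) |
        ∃ C D : Matrix (Fin n) (Fin n) ℚ, EncodesMatrix L₁ φ (u 0) C ∧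
          EncodesMatrix L₁ φ (u 1) D ∧ C * (g : Matrix (Fin n) (Fin n) ℚ) = D})
    {ψ : List (Fin n × Fin n → Option A) → G}
    (hψ : ∀ (w : List (Fin n × Fin n → Option A)) (g : G),
      EncodesMatrix L₁ φ w ((g : Matrix.GeneralLinearGroup (Fin n) ℚ) :
        Matrix (Fin n) (Fin n) ℚ) → ψ w = g) (S : Set G) :
    IsCayleyPFLinearTimeRepresentation S
      {w : List (Fin n × Fin n → Option A) | ∃ g ∈ G,
        EncodesMatrix L₁ φ w (g : Matrix (Fin n) (Fin n) ℚ)} ψ := by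
  refine ⟨⟨fun _ _ => Set.mem_univ _, ?_, ?_⟩, fun s _ => ?_⟩
  · rintro v ⟨g, hg, hv⟩ w ⟨h, hh, hw⟩ hvw
    rw [hψ v ⟨g, hg⟩ hv, hψ w ⟨h, hh⟩ hw] at hvw
    obtain rfl : g = h := congrArg Subtype.val hvw
    exact hv.word_unique hφ.injOn hw
  · rintro g -
    obtain ⟨w, hw⟩ := exists_encodesMatrix hφ.surjOn (hent g g.2)
    exact ⟨w, ⟨g, g.2, hw⟩, hψ w g hw⟩
  · obtain ⟨f, hf, hfR⟩ := exists_isPFLinearTimeComputable (hrec s s.2) (by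
      rintro u ⟨C, _, hu₀, hu₁, rfl⟩ v ⟨C', _, hv₀, hv₁, rfl⟩ huv
      rw [huv] at hu₀
      obtain rfl := hu₀.matrix_unique hv₀
      exact hu₁.word_unique hφ.injOn hv₁)
    refine ⟨f, hf, ?_⟩
    rintro w ⟨g, hg, hw⟩
    -- The product lies in `G`, so it has a code word, and `f` must return that word because the
    -- pair belongs to the graph.
    obtain ⟨v, hv⟩ := exists_encodesMatrix hφ.surjOn (hent (g * s) (G.mul_mem hg s.2))
    have hfw : f w = v := hfR ![w, v] ⟨_, _, hw, hv, (Units.val_mul g s).symm⟩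
    rw [hfw]
    exact ⟨⟨_, G.mul_mem hg s.2, hv⟩, by
      rw [hψ w ⟨g, hg⟩ hw, hψ v (⟨g, hg⟩ * s) hv]⟩

end Encodings

theorem theorem3p13 (n : ℕ) (G : Subgroup (Matrix.GeneralLinearGroup (Fin n) ℚ)) (hG : G.FG) :
    IsCayleyPFLinearTimeComputable G ∧
    ∃ (k : ℕ) (A : Type) (_ : Finite A) (L₁ : Set (List A)) (φ : List A → ℚ)
      (ψ : List (Fin n × Fin n → Option A) → G),
      0 < k ∧
      (∀ g ∈ G, ∀ i j, (g : Matrix (Fin n) (Fin n) ℚ) i j ∈ integersAdjoinInv k) ∧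
      IsFAPresentation k L₁ φ ∧
      (∀ g ∈ G, IsFARecognizable
        {u : Fin 2 → List (Fin n × Fin n → Option A) |
          ∃ C D : Matrix (Fin n) (Fin n) ℚ, EncodesMatrix L₁ φ (u 0) C ∧
            EncodesMatrix L₁ φ (u 1) D ∧ C * (g : Matrix (Fin n) (Fin n) ℚ) = D}) ∧
      (∀ (w : List (Fin n × Fin n → Option A)) (g : G),
        EncodesMatrix L₁ φ w ((g : Matrix.GeneralLinearGroup (Fin n) ℚ) :
          Matrix (Fin n) (Fin n) ℚ) → ψ w = g) ∧
      ∀ S : Set G, S.Finite →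
        IsCayleyPFLinearTimeRepresentation S
          {w : List (Fin n × Fin n → Option A) | ∃ g ∈ G,
            EncodesMatrix L₁ φ w (g : Matrix (Fin n) (Fin n) ℚ)} ψ := by
  classical
  obtain ⟨k, hk, hent⟩ := exists_entries_mem_integersAdjoinInv hG
  have hfin : Finite (DigitPair k) := finite_digitPair (by omega)
  -- The value 1 is taken only on words that encode no element of `G`.
  let ψ (w : List (Fin n × Fin n → Option (DigitPair k))) : G :=
    if h : ∃ g : G, EncodesMatrix (normalWords k) (wordValue k) w
      ((g : Matrix.GeneralLinearGroup (Fin n) ℚ) : Matrix (Fin n) (Fin n) ℚ) then h.choose else 1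
  have hψ (w) (g : G) (hw : EncodesMatrix (normalWords k) (wordValue k) w
      ((g : Matrix.GeneralLinearGroup (Fin n) ℚ) : Matrix (Fin n) (Fin n) ℚ)) : ψ w = g := by
    have h : ∃ g : G, EncodesMatrix (normalWords k) (wordValue k) w
      ((g : Matrix.GeneralLinearGroup (Fin n) ℚ) : Matrix (Fin n) (Fin n) ℚ) := ⟨g, hw⟩
    simp only [ψ, dif_pos h]
    exact Subtype.ext (Units.ext (h.choose_spec.matrix_unique hw))
  have hrep := isCayleyPFLinearTimeRepresentation_of_isFARecognizable (bijOn_wordValue hk) hent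
    (fun g _ => isFARecognizable_mul_matrix hk _) hψ
  exact ⟨⟨(Group.fg_iff_subgroup_fg G).2 hG, fun S _ _ => ⟨_, inferInstance, _, ψ, hrep S⟩⟩,
    k, DigitPair k, hfin, normalWords k, wordValue k, ψ, by omega, hent,
    isFAPresentation_wordValue hk, fun g _ => isFARecognizable_mul_matrix hk _, hψ,
    fun S _ => hrep S⟩
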